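/- Words are elements of the free semigroup $F$ over the alphabet $\{x_1,x_2,\dots\}$. For a word $u$, let $\ell(u)$ be its length, $\ell_i(u)$ the number of occurrences of $x_i$ in $u$, $c(u)$ the set of letters occurring in $u$, and $\mathrm{part}(u)$ the sequence of the numbers $\ell_i(u)$, $x_i\in c(u)$, written in non-increasing order. A semigroup variety is the class $\mathrm{var}\,\Sigma$ of all semigroups satisfying some system $\Sigma$ of identities $u\approx v$ ($u,v\in F$); the meet $\wedge$ of varieties is their intersection, $\mathcal{SEM}$ is the variety of all semigroups, and a variety is overcommutative if it contains all commutative semigroups. Let $\Lambda$ be the set of all partitions $\lambda=(\ell_1,\dots,\ell_m)$, $\ell_1\ge\dots\ge\ell_m\ge1$, $\ell_1+\dots+\ell_m=n$, of integers $n$ into $m$ parts with $2\le m\le n$. For such $\lambda$ let the transversal $W_\lambda$ be the set of all words $u$ with $\ell(u)=n$, $c(u)=\{x_1,\dots,x_m\}$, $\ell_i(u)\ge\ell_{i+1}(u)$ for $1\le i<m$, and $\mathrm{part}(u)=\lambda$. Put $\mathcal W_\lambda=\mathrm{var}\{u\approx v\mid u,v\in W_\lambda\}$. Let $q(\lambda)$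 be the number of components of $\lambda$ equal to $1$, $r(\lambda)$ the sum of the components greater than $1$, $\delta=0$ if $\lambda=(2,1)$ and $\delta=1$ otherwise, and $s(\lambda)=\max\{r(\lambda)-q(\lambda)-\delta,0\}$. For $k\ge0$ let $\lambda^k=(\ell_1,\dots,\ell_m,1,\dots,1)$ with $k$ additional ones, and put $\mathcal S_\lambda=\bigwedge_{i=0}^{s(\lambda)}\mathcal W_{\lambda^i}$. A variety $\mathcal V$ reduces [collapses] $W_\lambda$ if it satisfies $u\approx v$ for some distinct $u,v\in W_\lambda$ [for all $u,v\in W_\lambda$]; an overcommutative variety is greedy if it collapses every transversal $W_\lambda$, $\lambda\in\Lambda$, that it reduces. **Proposition.** Let $\mathcal V$ be an overcommutative semigroup variety. Then $\mathcal V$ is greedy if and only if either $\mathcal V=\mathcal{SEM}$ or $\mathcal V=\mathcal S_{\lambda_1}\wedge\dots\wedge\mathcal S_{\lambda_k}$ for some $k\ge1$ and some partitions $\lambda_1,\dots,\lambda_k\in\Lambda$. -/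

import Mathlib

universe u

namespace Overcomm

/-! ### Words

Words are elements of the free semigroup over a countably infinite alphabet. The letters are
indexed from `0`: the letter `x_{i+1}` is `FreeSemigroup.of i`. -/

/-- Words over the alphabet `x_1, x_2, …`. -/
abbrev Word : Type := FreeSemigroup ℕ

/-- The (nonempty) list of letters of a word. -/
def Word.letters (w : Word) : List ℕ := w.head :: w.tail

/-- The number of occurrences in `w` of the letter with index `i`. -/
def Word.occ (i : ℕ) (w : Word) : ℕ := w.letters.count i

/-- The set of letters occurring in `w`. -/
def Word.content (w : Word) : Finset ℕ := w.letters.toFinset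

/-- The numbers of occurrences of the letters of `w`, in non-increasing order. -/
def Word.part (w : Word) : List ℕ :=
  (w.content.val.map fun i => w.occ i).sort (· ≥ ·)

/-! ### Partitions -/

/-- A non-increasing finite sequence of positive integers with at least two components. -/
@[ext]
structure Lam where
  /-- The components. -/
  parts : List ℕ
  sorted : parts.Pairwise (· ≥ ·)
  pos : ∀ l ∈ parts, 0 < l
  two_le : 2 ≤ parts.length

namespace Lam

/-- The number being partitioned. -/
def n (lam : Lam) : ℕ := lam.parts.sum

/-- The number of components. -/
def m (lam : Lam) : ℕ := lam.parts.length

/-- The number of components equal to `1`. -/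
def q (lam : Lam) : ℕ := lam.parts.count 1

/-- The sum of the components greater than `1`. -/
def r (lam : Lam) : ℕ := (lam.parts.filter (1 < ·)).sum

/-- `0` for the partition `(2,1)` and `1` for every other one. -/
def delta (lam : Lam) : ℕ := if lam.parts = [2, 1] then 0 else 1

/-- `max {r - q - δ, 0}`, computed in the integers. -/
def s (lam : Lam) : ℕ := (max ((lam.r : ℤ) - lam.q - lam.delta) 0).toNat

/-- The partition obtained by appending `k` components equal to `1`. -/
def ext1 (lam : Lam) (k : ℕ) : Lam where
  parts := lam.parts ++ List.replicate k 1
  sorted := by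
    rw [List.pairwise_append]
    refine ⟨lam.sorted, List.pairwise_replicate.2 (Or.inr le_rfl), ?_⟩
    intro a ha b hb
    rw [List.eq_of_mem_replicate hb]
    exact lam.pos a ha
  pos := by
    intro l hl
    rcases List.mem_append.1 hl with h | h
    · exact lam.pos l h
    · rw [List.eq_of_mem_replicate h]; exact Nat.one_pos
  two_le := by
    rw [List.length_append]
    exact lam.two_le.trans (Nat.le_add_right _ _)

end Lam

/-- The transversal of a partition `lam` of `n` into `m` parts: the words `w` of length `n` in
exactly the letters `x_1, …, x_m`, with non-increasing numbers of occurrences of these letters,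
and with partition `lam`. -/
def transversal (lam : Lam) : Set Word :=
  {w | w.length = lam.n ∧ w.content = Finset.range lam.m ∧
    (∀ i, i + 1 < lam.m → w.occ (i + 1) ≤ w.occ i) ∧ w.part = lam.parts}

/-! ### Identities and varieties -/

/-- An identity `u ≈ v` is a pair of words. -/
abbrev Identity : Type := Word × Word

/-- The semigroup `S` satisfies the identity `e`: both sides agree under every substitution of
elements of `S` for the letters. -/
def Satisfies (S : Type u) [Semigroup S] (e : Identity) : Prop :=
  ∀ f : ℕ → S, FreeSemigroup.lift f e.1 = FreeSemigroup.lift f e.2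

/-- The class of all semigroups that satisfy every identity of `E`. -/
def var (E : Set Identity) : Set Semigrp.{u} :=
  {S | ∀ e ∈ E, Satisfies S e}

/-- A semigroup variety is a class of semigroups given by a system of identities. The meet of
varieties is their intersection, and the variety of all semigroups is `Set.univ`. -/
def IsVariety (V : Set Semigrp.{u}) : Prop := ∃ E : Set Identity, V = var E

/-- The class of all commutative semigroups. -/
def com : Set Semigrp.{u} := {S | ∀ a b : S, a * b = b * a}

/-- An overcommutative variety: a variety containing all commutative semigroups. -/
def IsOvercommutative (V : Set Semigrp.{u}) : Prop := IsVariety V ∧ com ⊆ V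

/-- The identity `e` holds in every semigroup of the class `V`. -/
def HoldsIn (V : Set Semigrp.{u}) (e : Identity) : Prop := ∀ S ∈ V, Satisfies S e

/-- `V` satisfies some non-trivial identity between words of the transversal. -/
def Reduces (V : Set Semigrp.{u}) (lam : Lam) : Prop :=
  ∃ a ∈ transversal lam, ∃ b ∈ transversal lam, a ≠ b ∧ HoldsIn V (a, b)

/-- `V` satisfies all identities between words of the transversal. -/
def Collapses (V : Set Semigrp.{u}) (lam : Lam) : Prop :=
  ∀ a ∈ transversal lam, ∀ b ∈ transversal lam, HoldsIn V (a, b)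

/-- `V` collapses every transversal it reduces. -/
def Greedy (V : Set Semigrp.{u}) : Prop := ∀ lam : Lam, Reduces V lam → Collapses V lam

/-- The variety given by all identities between words of the transversal of `lam`. -/
def varW (lam : Lam) : Set Semigrp.{u} :=
  var {e | e.1 ∈ transversal lam ∧ e.2 ∈ transversal lam}

/-- The meet of the varieties `varW (lam.ext1 i)` for `i = 0, 1, …, s(lam)`. -/
def varS (lam : Lam) : Set Semigrp.{u} :=
  ⋂ i ∈ Finset.range (lam.s + 1), varW (lam.ext1 i)

/-- Either `V` is the variety of all semigroups or `V` is the meet of a finite nonempty family of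
varieties of the form `varS lam`. -/
def ConditionVI (V : Set Semigrp.{u}) : Prop :=
  V = Set.univ ∨
    ∃ k : ℕ, 1 ≤ k ∧ ∃ lam : Fin k → Lam, V = ⋂ i : Fin k, varS (lam i)

end Overcomm

/-! A transversal is the set of all arrangements of one multiset of letters (`mem_transversal_iff`),
so collapsing it means that every arrangement of that multiset takes the same value.

The combinatorial core is `MsetCollapses.ext1_one`: if r ≤ q + 1 and λ ≠ (2,1), collapsing λ forces
collapsing λ¹. Each added 1 raises q and keeps r, so the hypothesis holds for λ^k from k = s(λ) on.
Hence the finitely many factors of S_λ already collapse every λ^k, and by substitution every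
multiset dominated by λ (`msetCollapses_of_dominates`). Conversely, the balanced identities on
dominated multisets, with the trivial ones, form a congruence stable under substitution. Its
quotient lies in every S_λ of the family, so the meet satisfies no other identities. A transversal
reduced by the meet is therefore dominated, hence collapsed (`greedy_iInter_varS`).

For the other direction, identities of an overcommutative variety are balanced, and a nontrivial one
can be renamed into a transversal, which a greedy variety collapses. Such a variety also passes from
λ to λ¹ (`Greedy.collapses_ext1`), so it is the meet of the S_λ over its collapsed λ. Higman's lemma
leaves finitely many of them (`exists_finset_dominates`). -/

namespace Overcomm

/-! ### Words and lists of letters -/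

/-- The multiset of letters of a word. -/
def Word.mset (w : Word) : Multiset ℕ := (w.letters : Multiset ℕ)

theorem Word.letters_injective : Function.Injective Word.letters := by
  rintro ⟨a, s⟩ ⟨b, t⟩ h
  simp only [Word.letters, List.cons.injEq] at h
  exact FreeSemigroup.ext h.1 h.2

theorem Word.exists_letters_eq {L : List ℕ} (h : L ≠ []) : ∃ w : Word, w.letters = L := by
  cases L with
  | nil => exact absurd rfl h
  | cons a t => exact ⟨⟨a, t⟩, rfl⟩

theorem Word.letters_mul (v w : Word) : (v * w).letters = v.letters ++ w.letters := rfl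

theorem Word.mset_mul (v w : Word) : (v * w).mset = v.mset + w.mset := by
  simp [Word.mset, Word.letters_mul]

theorem Word.mset_of (i : ℕ) : Word.mset (FreeSemigroup.of i) = {i} := rfl

theorem Word.mset_lift (f : ℕ → Word) (w : Word) :
    Word.mset (FreeSemigroup.lift f w) = w.mset.bind fun i => (f i).mset := by
  induction w using FreeSemigroup.recOnMul with
  | ih1 x => simp [Word.mset_of]
  | ih2 x y _ hy => rw [map_mul, Word.mset_mul, Word.mset_mul, hy]; simp [Word.mset_of]

/-! ### Evaluation of lists of letters -/

/-- The value in `S` with an adjoined unit of a list of letters. -/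
def evalList {S : Type*} [Semigroup S] (f : ℕ → S) (L : List ℕ) : WithOne S :=
  (L.map fun i => (f i : WithOne S)).prod

section evalList

variable {S : Type*} [Semigroup S]

@[simp]
theorem evalList_cons (f : ℕ → S) (a : ℕ) (L : List ℕ) :
    evalList f (a :: L) = (f a : WithOne S) * evalList f L := by
  simp [evalList]

@[simp]
theorem evalList_append (f : ℕ → S) (L L' : List ℕ) :
    evalList f (L ++ L') = evalList f L * evalList f L' := by
  simp [evalList]

@[simp]
theorem evalList_map (f : ℕ → S) (h : ℕ → ℕ) (L : List ℕ) :
    evalList f (L.map h) = evalList (f ∘ h) L := by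
  simp [evalList, Function.comp_def]

theorem evalList_congr {f g : ℕ → S} {L : List ℕ} (h : ∀ i ∈ L, f i = g i) :
    evalList f L = evalList g L := by
  unfold evalList
  congr 1
  exact List.map_congr_left fun i hi => by rw [h i hi]

theorem coe_lift (f : ℕ → S) (w : Word) :
    ((FreeSemigroup.lift f w : S) : WithOne S) = evalList f w.letters := by
  induction w using FreeSemigroup.recOnMul with
  | ih1 x => simp [Word.letters, evalList]
  | ih2 x y hx hy => rw [map_mul, WithOne.coe_mul, hx, hy, Word.letters_mul, evalList_append]

/-- The semigroup `S` satisfies the identity whose sides are the lists of letters `L`, `L'`. -/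
def ListSat (S : Type*) [Semigroup S] (L L' : List ℕ) : Prop :=
  ∀ f : ℕ → S, evalList f L = evalList f L'

theorem satisfies_iff {a b : Word} : Satisfies S (a, b) ↔ ListSat S a.letters b.letters := by
  simp only [Satisfies, ListSat, ← coe_lift, WithOne.coe_inj]

theorem ListSat.symm {L L' : List ℕ} (h : ListSat S L L') : ListSat S L' L :=
  fun f => (h f).symm

theorem ListSat.trans {L L' L'' : List ℕ} (h : ListSat S L L') (h' : ListSat S L' L'') :
    ListSat S L L'' :=
  fun f => (h f).trans (h' f)

theorem ListSat.cons {L L' : List ℕ} (h : ListSat S L L') (a : ℕ) :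
    ListSat S (a :: L) (a :: L') := by
  intro f
  rw [evalList_cons, evalList_cons, h f]

theorem ListSat.append {L L' : List ℕ} (h : ListSat S L L') (T : List ℕ) :
    ListSat S (L ++ T) (L' ++ T) := by
  intro f
  rw [evalList_append, evalList_append, h f]

theorem ListSat.map {L L' : List ℕ} (h : ListSat S L L') (g : ℕ → ℕ) :
    ListSat S (L.map g) (L'.map g) := by
  intro f
  rw [evalList_map, evalList_map, h]

/-- `S` satisfies all identities between the arrangements of the multiset `M`. -/
def MsetCollapses (S : Type*) [Semigroup S] (M : Multiset ℕ) : Prop :=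
  ∀ L L' : List ℕ, (L : Multiset ℕ) = M → (L' : Multiset ℕ) = M → ListSat S L L'

theorem exists_map_eq_of_coe_eq_map {α β : Type*} {M : Multiset α} {h : α → β} {L : List β}
    (hL : (L : Multiset β) = M.map h) : ∃ T : List α, (T : Multiset α) = M ∧ T.map h = L := by
  induction L generalizing M with
  | nil =>
    refine ⟨[], ?_, rfl⟩
    simpa [eq_comm] using hL
  | cons b L ih =>
    classical
    have hb : b ∈ M.map h := by rw [← hL]; simp
    obtain ⟨a, ha, rfl⟩ := Multiset.mem_map.1 hb
    obtain ⟨N, rfl⟩ := Multiset.exists_cons_of_mem ha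
    rw [← Multiset.cons_coe, Multiset.map_cons, Multiset.cons_inj_right] at hL
    obtain ⟨T, hT, hTL⟩ := ih hL
    exact ⟨a :: T, by rw [← hT]; rfl, by rw [List.map_cons, hTL]⟩

/-- Even when `h` identifies letters, each arrangement of the image lifts to an arrangement of `M`,
so the identities of `M` can be substituted into. -/
theorem MsetCollapses.map {M : Multiset ℕ} (hM : MsetCollapses S M) (h : ℕ → ℕ) :
    MsetCollapses S (M.map h) := by
  intro L L' hL hL'
  obtain ⟨T, hT, rfl⟩ := exists_map_eq_of_coe_eq_map hL
  obtain ⟨T', hT', rfl⟩ := exists_map_eq_of_coe_eq_map hL'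
  exact (hM T T' hT hT').map h

/-! ### Adding a letter that occurs once -/

/-- If no letter of `Z` is last in `L` and no two are adjacent, then letters from `Z` occupy at
most half of the positions of `L`. -/
theorem adjacent_or_last_or_count_le (Z : Finset ℕ) : ∀ L : List ℕ,
    (∃ L₁ a b L₂, a ∈ Z ∧ b ∈ Z ∧ L = L₁ ++ a :: b :: L₂) ∨
    (∃ a ∈ Z, ∃ L₀, L = L₀ ++ [a]) ∨
    2 * L.countP (· ∈ Z) ≤ L.length
  | [] => by simp
  | x :: L => by
    by_cases hx : x ∈ Z
    · cases L with
      | nil => exact Or.inr (Or.inl ⟨x, hx, [], rfl⟩)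
      | cons y L =>
        by_cases hy : y ∈ Z
        · exact Or.inl ⟨[], x, y, L, hx, hy, rfl⟩
        · rcases adjacent_or_last_or_count_le Z L with
            ⟨L₁, a, b, L₂, ha, hb, rfl⟩ | ⟨a, ha, L₀, rfl⟩ | h
          · exact Or.inl ⟨x :: y :: L₁, a, b, L₂, ha, hb, rfl⟩
          · exact Or.inr (Or.inl ⟨a, ha, x :: y :: L₀, rfl⟩)
          · refine Or.inr (Or.inr ?_)
            simp only [List.countP_cons, List.length_cons, hx, hy]
            simp
            omega
    · rcases adjacent_or_last_or_count_le Z L with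
        ⟨L₁, a, b, L₂, ha, hb, rfl⟩ | ⟨a, ha, L₀, rfl⟩ | h
      · exact Or.inl ⟨x :: L₁, a, b, L₂, ha, hb, rfl⟩
      · exact Or.inr (Or.inl ⟨a, ha, x :: L₀, rfl⟩)
      · refine Or.inr (Or.inr ?_)
        simp only [List.countP_cons, List.length_cons, hx]
        simp
        omega

theorem countP_mem_eq_card {N : Multiset ℕ} {Z : Finset ℕ} (hZ : ∀ a ∈ Z, N.count a = 1) :
    N.countP (· ∈ Z) = Z.card := by
  have : N.filter (· ∈ Z) = Z.val := by
    ext a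
    by_cases ha : a ∈ Z
    · rw [Multiset.count_filter_of_pos ha, hZ a ha]
      exact (Multiset.count_eq_one_of_mem Z.nodup ha).symm
    · rw [Multiset.count_filter_of_neg ha, Multiset.count_eq_zero_of_notMem (s := Z.val) ha]
  rw [Multiset.countP_eq_card_filter, this]
  rfl

/-- Two adjacent letters occurring once can be moved together to the beginning. -/
theorem listSat_adjacent_front {L₁ L₂ : List ℕ} {a b : ℕ}
    (hb : b ∉ L₁ ++ L₂) (h : MsetCollapses S (b ::ₘ (L₁ ++ L₂ : List ℕ))) :
    ListSat S (L₁ ++ a :: b :: L₂) (a :: b :: (L₁ ++ L₂)) := by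
  intro f
  -- Substituting ab for b in the identity that moves b to the front carries the block ab along.
  have key := h (L₁ ++ b :: L₂) (b :: (L₁ ++ L₂)) (by
    rw [Multiset.cons_coe, Multiset.coe_eq_coe]; exact List.perm_middle) rfl
    (Function.update f b (f a * f b))
  rw [List.mem_append, not_or] at hb
  have h₁ : evalList (Function.update f b (f a * f b)) L₁ = evalList f L₁ :=
    evalList_congr fun i hi => Function.update_of_ne (by rintro rfl; exact hb.1 hi) _ _
  have h₂ : evalList (Function.update f b (f a * f b)) L₂ = evalList f L₂ :=
    evalList_congr fun i hi => Function.update_of_ne (by rintro rfl; exact hb.2 hi) _ _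
  simpa [h₁, h₂, mul_assoc] using key

section

variable {N : Multiset ℕ} {Z : Finset ℕ}

/-- First half of `MsetCollapses.of_erase`. If the first letter is outside `Z`, the letters of `Z`
fill more than half of the tail, so two are adjacent or one is last; either configuration lets a
letter of `Z` reach the front. -/
theorem exists_listSat_cons (hZ : ∀ a ∈ Z, N.count a = 1) (hZ3 : 3 ≤ Z.card)
    (hN : N.card ≤ 2 * Z.card) (h : ∀ a ∈ Z, MsetCollapses S (N.erase a))
    {L : List ℕ} (hL : (L : Multiset ℕ) = N) :
    ∃ a ∈ Z, ∃ T : List ℕ, ((a :: T : List ℕ) : Multiset ℕ) = N ∧ ListSat S L (a :: T) := by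
  have hcount : L.countP (· ∈ Z) = Z.card := by
    rw [← countP_mem_eq_card hZ, ← hL, Multiset.coe_countP]
  have hlen : L.length ≤ 2 * Z.card := by
    rw [← hL] at hN; exact hN
  cases L with
  | nil => simp at hcount; omega
  | cons x L =>
    by_cases hx : x ∈ Z
    · exact ⟨x, hx, L, hL, fun _ => rfl⟩
    · have hx' : (x :: L).countP (· ∈ Z) = L.countP (· ∈ Z) := by
        simp [hx]
      rcases adjacent_or_last_or_count_le Z L with
        ⟨L₁, a, b, L₂, ha, hb, rfl⟩ | ⟨a, ha, L₀, rfl⟩ | hle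
      · have hL' : a ::ₘ b ::ₘ (((x :: L₁) ++ L₂ : List ℕ) : Multiset ℕ) = N := by
          rw [← hL, Multiset.cons_coe, Multiset.cons_coe, Multiset.coe_eq_coe]
          exact ((List.perm_middle (l₁ := x :: L₁)).trans
            (List.Perm.cons a (List.perm_middle (l₁ := x :: L₁)))).symm
        have hbn : b ∉ (x :: L₁) ++ L₂ := by
          intro hmem
          have h1 := hZ b hb
          have h2 : 0 < Multiset.count b (((x :: L₁) ++ L₂ : List ℕ) : Multiset ℕ) :=
            Multiset.count_pos.2 hmem
          rw [← hL', Multiset.count_cons, Multiset.count_cons_self] at h1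
          omega
        refine ⟨a, ha, b :: ((x :: L₁) ++ L₂), hL', ?_⟩
        refine listSat_adjacent_front (L₁ := x :: L₁) hbn ?_
        have := h a ha
        rwa [← hL', Multiset.erase_cons_head] at this
      -- With the final a set aside, the prefix arranges a collapsed multiset, so any other b from
      -- `Z` can be moved to its front.
      · obtain ⟨b, hb, hba⟩ : ∃ b ∈ Z, b ≠ a := Finset.exists_mem_ne (by omega) a
        have hE : N.erase a = ((x :: L₀ : List ℕ) : Multiset ℕ) := by
          rw [← hL, ← List.cons_append]
          have : ((x :: L₀ ++ [a] : List ℕ) : Multiset ℕ) = a ::ₘ ((x :: L₀ : List ℕ)) := by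
            rw [Multiset.cons_coe, Multiset.coe_eq_coe]
            exact List.perm_append_singleton _ _
          rw [this, Multiset.erase_cons_head]
        have hbm : b ∈ x :: L₀ := by
          have h1 := hZ b hb
          rw [← Multiset.count_erase_of_ne hba, hE] at h1
          exact Multiset.count_pos.1 (by omega : 0 < Multiset.count b ((x :: L₀ : List ℕ)))
        have hperm := List.perm_cons_erase hbm
        refine ⟨b, hb, (x :: L₀).erase b ++ [a], ?_, ?_⟩
        · rw [← hL, Multiset.coe_eq_coe]
          exact (hperm.append_right [a]).symm
        · have := h a ha (x :: L₀) (b :: (x :: L₀).erase b) hE.symm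
            (by rw [hE, Multiset.coe_eq_coe]; exact hperm.symm)
          exact this.append [a]
      · rw [hx'] at hcount
        simp only [List.length_cons] at hlen
        omega

/-- If the letters from `Z` occur once in `N`, occupy at least half of it, and `S` collapses `N`
without any one of them, then `S` collapses `N`. -/
theorem MsetCollapses.of_erase (hZ : ∀ a ∈ Z, N.count a = 1) (hZ3 : 3 ≤ Z.card)
    (hN : N.card ≤ 2 * Z.card) (h : ∀ a ∈ Z, MsetCollapses S (N.erase a)) :
    MsetCollapses S N := by
  intro L L' hL hL'
  obtain ⟨a, ha, T, hT, hLT⟩ := exists_listSat_cons hZ hZ3 hN h hL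
  obtain ⟨b, hb, T', hT', hLT'⟩ := exists_listSat_cons hZ hZ3 hN h hL'
  refine hLT.trans (ListSat.trans ?_ hLT'.symm)
  -- A third letter c links the two words: behind the fixed first letter it moves to the end, and
  -- then the prefixes are arrangements of the collapsed multiset `N.erase c`. This needs `3 ≤
  -- Z.card`.
  obtain ⟨c, hc, hca, hcb⟩ : ∃ c ∈ Z, c ≠ a ∧ c ≠ b := by
    have : 0 < ((Z.erase a).erase b).card := by
      have h1 := Finset.pred_card_le_card_erase (s := Z) (a := a)
      have h2 := Finset.pred_card_le_card_erase (s := Z.erase a) (a := b)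
      omega
    obtain ⟨c, hc⟩ := Finset.card_pos.1 this
    simp only [Finset.mem_erase] at hc
    exact ⟨c, hc.2.2, hc.2.1, hc.1⟩
  have aux : ∀ d ∈ Z, c ≠ d → ∀ U : List ℕ, ((d :: U : List ℕ) : Multiset ℕ) = N →
      ∃ X : List ℕ, ((d :: X : List ℕ) : Multiset ℕ) = N.erase c ∧
        ListSat S (d :: U) (d :: X ++ [c]) := by
    intro d hd hcd U hU
    have hcU : c ∈ U := by
      have : c ∈ (d :: U) := by
        rw [← Multiset.mem_coe, hU]
        exact Multiset.count_pos.1 (by rw [hZ c hc]; exact Nat.one_pos)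
      rcases List.mem_cons.1 this with h | h
      · exact absurd h hcd
      · exact h
    refine ⟨U.erase c, ?_, ?_⟩
    · rw [← hU, ← Multiset.cons_coe, ← Multiset.cons_coe, Multiset.erase_cons_tail _ hcd.symm,
        Multiset.coe_erase]
    · refine ListSat.cons (h d hd _ _ ?_ ?_) d
      · rw [← hU, ← Multiset.cons_coe, Multiset.erase_cons_head]
      · rw [← hU, ← Multiset.cons_coe, Multiset.erase_cons_head, Multiset.coe_eq_coe]
        exact (List.perm_append_singleton _ _).trans (List.perm_cons_erase hcU).symm
  obtain ⟨X, hX, hTX⟩ := aux a ha hca T hT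
  obtain ⟨Y, hY, hTY⟩ := aux b hb hcb T' hT'
  exact hTX.trans (((h c hc _ _ hX hY).append [c]).trans hTY.symm)

/-- Collapsing a multiset is inherited by its extension by a new letter, if sufficiently many
letters of the extension occur once. -/
theorem MsetCollapses.cons {M : Multiset ℕ} {z : ℕ} (hz : z ∉ M) (hM : MsetCollapses S M)
    (hZ : ∀ a ∈ Z, (z ::ₘ M).count a = 1) (hZ3 : 3 ≤ Z.card)
    (hN : (z ::ₘ M).card ≤ 2 * Z.card) : MsetCollapses S (z ::ₘ M) := by
  refine MsetCollapses.of_erase hZ hZ3 hN fun a ha => ?_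
  by_cases haz : a = z
  · rw [haz, Multiset.erase_cons_head]; exact hM
  · have h1 := hZ a ha
    rw [Multiset.count_cons_of_ne haz] at h1
    obtain ⟨M₀, rfl⟩ := Multiset.exists_cons_of_mem (Multiset.count_pos.1 (h1 ▸ Nat.one_pos))
    rw [Multiset.count_cons_self, Nat.add_eq_right, Multiset.count_eq_zero] at h1
    rw [Multiset.mem_cons, not_or] at hz
    -- Deleting a from the extension leaves a copy of `M` in which z plays the role of a.
    have hmap : (a ::ₘ M₀).map (Equiv.swap a z) = (z ::ₘ a ::ₘ M₀).erase a := by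
      rw [Multiset.cons_swap, Multiset.erase_cons_head, Multiset.map_cons, Equiv.swap_apply_left]
      congr 1
      conv_rhs => rw [← Multiset.map_id M₀]
      refine Multiset.map_congr rfl fun i hi => ?_
      exact Equiv.swap_apply_of_ne_of_ne (by rintro rfl; exact h1 hi)
        (by rintro rfl; exact hz.2 hi)
    rw [← hmap]
    exact hM.map _

end

end evalList

/-! ### The letters of a transversal -/

/-- The multiset of letters shared by the words of the transversal of `lam`. -/
def Lam.mset (lam : Lam) : Multiset ℕ :=
  ∑ i ∈ Finset.range lam.m, Multiset.replicate (lam.parts.getD i 0) i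

theorem Lam.getD_of_le (lam : Lam) {i : ℕ} (h : lam.m ≤ i) : lam.parts.getD i 0 = 0 :=
  List.getD_eq_default _ _ h

theorem Lam.getD_pos (lam : Lam) {i : ℕ} (h : i < lam.m) : 0 < lam.parts.getD i 0 := by
  rw [List.getD_eq_getElem _ _ h]
  exact lam.pos _ (List.getElem_mem _)

theorem Lam.count_mset (lam : Lam) (i : ℕ) : lam.mset.count i = lam.parts.getD i 0 := by
  unfold Lam.mset
  rw [Multiset.count_sum']
  simp only [Multiset.count_replicate]
  rw [Finset.sum_ite_eq' (Finset.range lam.m) i]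
  split_ifs with h
  · rfl
  · exact (lam.getD_of_le (by simpa using h)).symm

theorem Lam.mem_mset (lam : Lam) {i : ℕ} : i ∈ lam.mset ↔ i < lam.m := by
  rw [← Multiset.count_pos, lam.count_mset]
  refine ⟨fun h => ?_, lam.getD_pos⟩
  by_contra hi
  rw [lam.getD_of_le (not_lt.1 hi)] at h
  exact absurd h (lt_irrefl 0)

theorem map_getD_range (l : List ℕ) : (List.range l.length).map (fun i => l.getD i 0) = l := by
  apply List.ext_getElem (by simp)
  intro i h1 h2
  simp [h2]

theorem Lam.card_mset (lam : Lam) : lam.mset.card = lam.n := by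
  unfold Lam.mset Lam.n Lam.m
  conv_rhs => rw [← map_getD_range lam.parts]
  rw [Multiset.card_sum]
  simp only [Multiset.card_replicate]
  rfl

theorem Word.occ_eq_count (w : Word) (i : ℕ) : w.occ i = w.mset.count i := by
  simp [Word.occ, Word.mset]

theorem sort_map_occ_range {w : Word} {m : ℕ} (h : ∀ i, i + 1 < m → w.occ (i + 1) ≤ w.occ i) :
    ((Finset.range m).val.map fun i => w.occ i).sort (· ≥ ·) =
      (List.range m).map fun i => w.occ i := by
  have hs : ((List.range m).map fun i => w.occ i).Pairwise (· ≥ ·) := by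
    rw [← List.isChain_iff_pairwise, List.isChain_iff_getElem]
    intro i hi
    simp only [List.getElem_map, List.getElem_range]
    exact h i (by simpa using hi)
  refine List.Perm.eq_of_pairwise (fun a b _ _ h1 h2 => le_antisymm h2 h1)
    (Multiset.pairwise_sort _ _) hs ?_
  rw [← Multiset.coe_eq_coe, Multiset.sort_eq]
  rfl

/-- Since the occurrence numbers already decrease along the alphabet, sorting them changes nothing,
and the partition records the multiplicity of each letter. -/
theorem mem_transversal_iff {lam : Lam} {w : Word} :
    w ∈ transversal lam ↔ w.mset = lam.mset := by
  constructor
  · rintro ⟨-, hc, hd, hp⟩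
    unfold Word.part at hp
    rw [hc, sort_map_occ_range hd] at hp
    ext i
    rw [← Word.occ_eq_count, lam.count_mset]
    by_cases hi : i < lam.m
    · rw [← hp, List.getD_eq_getElem _ _ (by simpa using hi)]
      simp
    · rw [lam.getD_of_le (not_lt.1 hi)]
      apply List.count_eq_zero.2
      intro hmem
      have : i ∈ w.content := List.mem_toFinset.2 hmem
      rw [hc, Finset.mem_range] at this
      exact hi this
  · intro h
    have hocc : ∀ i, w.occ i = lam.parts.getD i 0 := fun i => by
      rw [Word.occ_eq_count, h, lam.count_mset]
    have hcont : w.content = Finset.range lam.m := by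
      ext i
      rw [Finset.mem_range, ← lam.mem_mset, ← h]
      simp [Word.content, Word.mset]
    have hdec : ∀ i, i + 1 < lam.m → w.occ (i + 1) ≤ w.occ i := by
      intro i hi
      rw [hocc, hocc, List.getD_eq_getElem _ _ hi,
        List.getD_eq_getElem _ _ ((Nat.lt_succ_self i).trans hi)]
      exact List.pairwise_iff_getElem.1 lam.sorted i (i + 1) _ _ (Nat.lt_succ_self i)
    refine ⟨?_, hcont, hdec, ?_⟩
    · rw [← lam.card_mset, ← h]
      simp [FreeSemigroup.length, Word.mset, Word.letters]
    · unfold Word.part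
      rw [hcont, sort_map_occ_range hdec]
      simp only [hocc]
      exact map_getD_range lam.parts

theorem msetCollapses_iff {S : Type*} [Semigroup S] {lam : Lam} :
    MsetCollapses S lam.mset ↔
      ∀ a ∈ transversal lam, ∀ b ∈ transversal lam, Satisfies S (a, b) := by
  constructor
  · intro h a ha b hb
    exact satisfies_iff.2 (h _ _ (mem_transversal_iff.1 ha) (mem_transversal_iff.1 hb))
  · intro h L L' hL hL'
    have h0 : (0 : ℕ) ∈ lam.mset := lam.mem_mset.2 (lt_of_lt_of_le two_pos lam.two_le)
    have ne : ∀ T : List ℕ, (T : Multiset ℕ) = lam.mset → T ≠ [] := by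
      rintro T hT rfl
      rw [← hT] at h0
      simp at h0
    obtain ⟨a, rfl⟩ := Word.exists_letters_eq (ne L hL)
    obtain ⟨b, rfl⟩ := Word.exists_letters_eq (ne L' hL')
    exact satisfies_iff.1 (h a (mem_transversal_iff.2 hL) b (mem_transversal_iff.2 hL'))

theorem collapses_iff {V : Set Semigrp.{u}} {lam : Lam} :
    Collapses V lam ↔ ∀ S ∈ V, MsetCollapses S lam.mset := by
  simp only [msetCollapses_iff, Collapses, HoldsIn]
  tauto

theorem mem_varW_iff {S : Semigrp.{u}} {lam : Lam} :
    S ∈ varW lam ↔ MsetCollapses S lam.mset := by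
  simp only [msetCollapses_iff, varW, var, Set.mem_ofPred_eq, Prod.forall]
  tauto

/-! ### Appending components equal to `1` -/

theorem Lam.ext1_zero (lam : Lam) : lam.ext1 0 = lam := by
  ext1; simp [Lam.ext1]

theorem Lam.ext1_succ (lam : Lam) (k : ℕ) : lam.ext1 (k + 1) = (lam.ext1 k).ext1 1 := by
  ext1; simp [Lam.ext1, List.replicate_succ']

theorem Lam.m_ext1 (lam : Lam) (k : ℕ) : (lam.ext1 k).m = lam.m + k := by
  simp [Lam.ext1, Lam.m]

theorem Lam.mset_ext1_one (lam : Lam) : (lam.ext1 1).mset = lam.m ::ₘ lam.mset := by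
  unfold Lam.mset
  rw [Lam.m_ext1, Finset.sum_range_succ, add_comm, ← Multiset.singleton_add]
  congr 1
  · simp [Lam.ext1, Lam.m]
  · refine Finset.sum_congr rfl fun i hi => ?_
    simp only [Lam.ext1]
    rw [List.getD_append _ _ _ _ (by simpa [Lam.m] using hi)]

theorem Lam.mset_ext1 (lam : Lam) (k : ℕ) :
    (lam.ext1 k).mset = lam.mset + (List.range k).map (lam.m + ·) := by
  induction k with
  | zero => simp [Lam.ext1_zero]
  | succ k ih =>
    rw [Lam.ext1_succ, Lam.mset_ext1_one, Lam.m_ext1, ih, List.range_succ]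
    simp only [List.map_append, List.map_cons, List.map_nil]
    rw [← Multiset.coe_add, ← Multiset.add_cons, ← add_assoc, Multiset.coe_singleton,
      ← Multiset.singleton_add]
    abel

theorem sum_eq_count_add_sum_filter (l : List ℕ) :
    l.sum = l.count 1 + (l.filter (1 < ·)).sum := by
  induction l with
  | nil => rfl
  | cons a l ih =>
    rw [List.sum_cons, ih, List.count_cons, List.filter_cons]
    rcases Nat.lt_trichotomy a 1 with h | rfl | h
    · have : a = 0 := by omega
      subst this
      simp
    · simp; omega
    · have : a ≠ 1 := by omega
      simp [h, this]; omega

theorem Lam.n_eq (lam : Lam) : lam.n = lam.q + lam.r := sum_eq_count_add_sum_filter lam.parts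

theorem Lam.q_ext1 (lam : Lam) (k : ℕ) : (lam.ext1 k).q = lam.q + k := by
  simp [Lam.q, Lam.ext1]

theorem Lam.r_ext1 (lam : Lam) (k : ℕ) : (lam.ext1 k).r = lam.r := by
  simp [Lam.r, Lam.ext1]

/-- The letters that occur once in the words of the transversal. -/
def Lam.linear (lam : Lam) : Finset ℕ :=
  (Finset.range lam.m).filter fun i => lam.parts.getD i 0 = 1

theorem Lam.card_linear (lam : Lam) : lam.linear.card = lam.q := by
  have h := congrArg (List.count 1) (map_getD_range lam.parts)
  unfold Lam.q
  rw [← h, List.count, List.countP_map, List.countP_eq_length_filter]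
  rw [Lam.linear, Finset.card_def, Finset.filter_val, Finset.range_val, ← Multiset.coe_range,
    Multiset.filter_coe, Multiset.coe_card, Lam.m]
  congr 2

theorem two_mul_length_le {l : List ℕ} (h : ∀ a ∈ l, 0 < a) :
    2 * l.length ≤ l.count 1 + l.sum := by
  induction l with
  | nil => simp
  | cons a l ih =>
    have := ih fun b hb => h b (List.mem_cons_of_mem a hb)
    have ha := h a List.mem_cons_self
    rw [List.sum_cons, List.length_cons, List.count_cons]
    by_cases h1 : a = 1
    · simp [h1]; omega
    · simp [h1]; omega

/-- Components other than 1 are at least 2, so 4 ≤ 2m ≤ q + n = 2q + r ≤ 3q + 1. If q ≤ 1, this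
forces q = 1, m = 2 and n = 3, which is (2,1). -/
theorem Lam.two_le_q (lam : Lam) (h : lam.r ≤ lam.q + 1) (hne : lam.parts ≠ [2, 1]) :
    2 ≤ lam.q := by
  by_contra hq
  have h1 : 2 * lam.m ≤ lam.q + lam.n := two_mul_length_le lam.pos
  have h2 := lam.n_eq
  have h3 : 2 ≤ lam.m := lam.two_le
  have hm : lam.parts.length = 2 := by
    change lam.m = 2
    omega
  have hn : lam.parts.sum = 3 := by
    change lam.n = 3
    omega
  obtain ⟨x, y, hxy⟩ := List.length_eq_two.1 hm
  have hle := lam.sorted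
  have hy := lam.pos y (by simp [hxy])
  rw [hxy] at hle hn
  simp at hle hn
  apply hne
  rw [hxy]
  obtain rfl : x = 2 := by omega
  obtain rfl : y = 1 := by omega
  rfl

/-- λ¹ has q + 1 letters occurring once among q + r + 1 positions: they fill at least half exactly
when r ≤ q + 1, and there are three of them once q ≥ 2. -/
theorem MsetCollapses.ext1_one {S : Type*} [Semigroup S] {lam : Lam}
    (h : MsetCollapses S lam.mset) (hr : lam.r ≤ lam.q + 1) (hne : lam.parts ≠ [2, 1]) :
    MsetCollapses S (lam.ext1 1).mset := by
  have hq := lam.two_le_q hr hne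
  have hn := lam.n_eq
  rw [Lam.mset_ext1_one]
  refine MsetCollapses.cons (Z := (lam.ext1 1).linear) ?_ h ?_ ?_ ?_
  · rw [lam.mem_mset]; exact lt_irrefl _
  · intro a ha
    rw [← Lam.mset_ext1_one, Lam.count_mset]
    exact (Finset.mem_filter.1 ha).2
  · rw [Lam.card_linear, Lam.q_ext1]; omega
  · rw [Lam.card_linear, Lam.q_ext1, Multiset.card_cons, Lam.card_mset]; omega

theorem msetCollapses_ext1_of_mem_varS {S : Semigrp.{u}} {lam : Lam} (h : S ∈ varS lam) (k : ℕ) :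
    MsetCollapses S (lam.ext1 k).mset := by
  have base : ∀ i ≤ lam.s, MsetCollapses S (lam.ext1 i).mset := by
    intro i hi
    simp only [varS, Set.mem_iInter, Finset.mem_range] at h
    exact mem_varW_iff.1 (h i (Nat.lt_succ_of_le hi))
  rcases le_total k lam.s with hk | hk
  · exact base k hk
  · induction k, hk using Nat.le_induction with
    | base => exact base _ le_rfl
    | succ k hk ih =>
      rw [Lam.ext1_succ]
      have hs : (lam.r : ℤ) - lam.q - lam.delta ≤ k := by
        have : ((lam.s : ℕ) : ℤ) ≤ k := by exact_mod_cast hk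
        refine le_trans ?_ this
        rw [Lam.s, Int.toNat_of_nonneg (le_max_right _ _)]
        exact le_max_left _ _
      refine ih.ext1_one ?_ ?_
      · rw [Lam.r_ext1, Lam.q_ext1]
        have : lam.delta ≤ 1 := by unfold Lam.delta; split_ifs <;> simp
        omega
      -- Only λ = (2,1) with k = 0 gives λ^k = (2,1), but there δ = 0 makes s(λ) = 1 > k. This is
      -- why δ is exceptional at (2,1).
      · intro he
        have hm : lam.m + k = 2 := by
          rw [← Lam.m_ext1, Lam.m, he]; rfl
        have h2 : 2 ≤ lam.m := lam.two_le
        obtain rfl : k = 0 := by omega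
        rw [Lam.ext1_zero] at he
        have hd : lam.delta = 0 := by simp [Lam.delta, he]
        have hr : lam.r = 2 := by rw [Lam.r, he]; rfl
        have hq : lam.q = 1 := by rw [Lam.q, he]; rfl
        rw [hd, hr, hq] at hs
        norm_num at hs

/-! ### Dominated multisets -/

/-- Identifying letters in the words of the transversal of `lam` gives subwords of arrangements
of `M`. -/
def Dominates (lam : Lam) (M : Multiset ℕ) : Prop := ∃ g : ℕ → ℕ, lam.mset.map g ≤ M

theorem Dominates.mono {lam : Lam} {M N : Multiset ℕ} (h : Dominates lam M) (hMN : M ≤ N) :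
    Dominates lam N :=
  h.imp fun _ hg => hg.trans hMN

/-- Each substituted word contains its own first letter, so following `g` by "first letter of the
image" still fits. This makes `dominatedCon` stable under substitution. -/
theorem Dominates.mset_lift {lam : Lam} {w : Word} (h : Dominates lam w.mset) (f : ℕ → Word) :
    Dominates lam (Word.mset (FreeSemigroup.lift f w)) := by
  obtain ⟨g, hg⟩ := h
  refine ⟨fun i => (f (g i)).head, ?_⟩
  have h1 := Multiset.map_le_map (f := fun i => (f i).head) hg
  rw [Multiset.map_map] at h1
  refine h1.trans ?_
  rw [Word.mset_lift]
  induction w.mset using Multiset.induction_on with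
  | empty => simp
  | cons a M ih =>
    rw [Multiset.map_cons, Multiset.cons_bind, ← Multiset.singleton_add]
    refine add_le_add ?_ ih
    rw [Multiset.singleton_le]
    simp [Word.mset, Word.letters]

theorem dominates_mset_ext1 (lam : Lam) (k : ℕ) : Dominates lam (lam.ext1 k).mset :=
  ⟨id, by rw [Multiset.map_id, Lam.mset_ext1]; exact Multiset.le_add_right _ _⟩

theorem msetCollapses_of_dominates {S : Semigrp.{u}} {lam : Lam} (hS : S ∈ varS lam)
    {M : Multiset ℕ} (h : Dominates lam M) : MsetCollapses S M := by
  obtain ⟨g, hg⟩ := h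
  obtain ⟨R, rfl⟩ := Multiset.le_iff_exists_add.1 hg
  obtain ⟨l, rfl⟩ := Quot.exists_rep R
  -- Use as many additional ones as there are leftover letters: the original letters follow `g`, the
  -- added ones enumerate `l`.
  have := (msetCollapses_ext1_of_mem_varS hS l.length).map
    fun i => if i < lam.m then g i else l.getD (i - lam.m) 0
  convert this using 1
  rw [Lam.mset_ext1, Multiset.map_add]
  congr 1
  · refine Multiset.map_congr rfl fun i hi => ?_
    rw [if_pos (lam.mem_mset.1 hi)]
  · rw [Multiset.map_coe, List.map_map]
    conv_lhs => rw [← map_getD_range l]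
    refine congrArg _ (List.map_congr_left fun i _ => ?_)
    simp

/-- The sublist embedding of positions is an injective renaming of letters, so multiplicities can be
compared one by one. This connects domination with Higman's order. -/
theorem dominates_of_sublistForall₂ {lam mu : Lam}
    (h : List.SublistForall₂ (· ≤ ·) lam.parts mu.parts) : Dominates lam mu.mset := by
  obtain ⟨l, hl, hsub⟩ := List.sublistForall₂_iff.1 h
  obtain ⟨f, hf⟩ := List.sublist_iff_exists_orderEmbedding_getElem?_eq.1 hsub
  refine ⟨f, Multiset.le_iff_count.2 fun j => ?_⟩
  by_cases hj : ∃ i, f i = j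
  · obtain ⟨i, rfl⟩ := hj
    rw [Multiset.count_map_eq_count' _ _ f.injective, Lam.count_mset, Lam.count_mset,
      List.getD_eq_getElem?_getD (l := mu.parts), ← hf i, ← List.getD_eq_getElem?_getD]
    by_cases hi : i < lam.parts.length
    · rw [List.getD_eq_getElem _ _ hi, List.getD_eq_getElem _ _ (hl.length_eq ▸ hi)]
      exact List.Forall₂.get hl hi _
    · rw [List.getD_eq_default _ _ (not_lt.1 hi)]
      exact Nat.zero_le _
  · rw [Multiset.count_eq_zero_of_notMem]
    · exact Nat.zero_le _
    · intro hmem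
      obtain ⟨i, -, hi⟩ := Multiset.mem_map.1 hmem
      exact hj ⟨i, hi⟩

/-! ### Meets of the varieties `varS lam` are greedy -/

/-- The identities between words with the same multiset of letters, if it is dominated by a
member of the family `lam`. -/
def dominatedCon {ι : Type*} (lam : ι → Lam) : Con Word where
  r a b := a = b ∨ (a.mset = b.mset ∧ ∃ i, Dominates (lam i) a.mset)
  iseqv :=
    { refl := fun _ => Or.inl rfl
      symm := by
        rintro a b (rfl | ⟨h, i, hi⟩)
        · exact Or.inl rfl
        · exact Or.inr ⟨h.symm, i, h ▸ hi⟩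
      trans := by
        rintro a b c (rfl | ⟨h, i, hi⟩) h'
        · exact h'
        · rcases h' with rfl | ⟨h', -⟩
          · exact Or.inr ⟨h, i, hi⟩
          · exact Or.inr ⟨h.trans h', i, hi⟩ }
  mul' := by
    rintro a b c d (rfl | ⟨h, i, hi⟩) (rfl | ⟨h', j, hj⟩)
    · exact Or.inl rfl
    · refine Or.inr ⟨by rw [Word.mset_mul, Word.mset_mul, h'], j, hj.mono ?_⟩
      rw [Word.mset_mul]; exact Multiset.le_add_left _ _
    · refine Or.inr ⟨by rw [Word.mset_mul, Word.mset_mul, h], i, hi.mono ?_⟩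
      rw [Word.mset_mul]; exact Multiset.le_add_right _ _
    · refine Or.inr ⟨by rw [Word.mset_mul, Word.mset_mul, h, h'], i, hi.mono ?_⟩
      rw [Word.mset_mul]; exact Multiset.le_add_right _ _

theorem dominatedCon_iff {ι : Type*} {lam : ι → Lam} {a b : Word} :
    dominatedCon lam a b ↔ a = b ∨ (a.mset = b.mset ∧ ∃ i, Dominates (lam i) a.mset) :=
  Iff.rfl

/-- The test semigroups live in `Type`, whereas the classes consist of semigroups in an arbitrary
universe. -/
theorem satisfies_ulift_iff {S : Type} [Semigroup S] {e : Identity} :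
    Satisfies (ULift.{u} S) e ↔ Satisfies S e := by
  have key : ∀ (f : ℕ → ULift.{u} S) (w : Word),
      (FreeSemigroup.lift f w).down = FreeSemigroup.lift (fun i => (f i).down) w := by
    intro f w
    induction w using FreeSemigroup.recOnMul with
    | ih1 x => simp
    | ih2 x y hx hy => rw [map_mul, map_mul, ULift.mul_down, hx, hy]
  constructor
  · intro h f
    have := congrArg ULift.down (h fun i => ⟨f i⟩)
    rwa [key, key] at this
  · intro h f
    refine ULift.ext _ _ ?_
    rw [key, key]
    exact h _

theorem lift_mk (c : Con Word) (f : ℕ → Word) (w : Word) :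
    FreeSemigroup.lift (fun i => (f i : c.Quotient)) w =
      ((FreeSemigroup.lift f w : Word) : c.Quotient) := by
  induction w using FreeSemigroup.recOnMul with
  | ih1 x => simp
  | ih2 x y hx hy => rw [map_mul, map_mul, Con.coe_mul, hx, hy]

theorem satisfies_quotient_iff {c : Con Word} {a b : Word} :
    Satisfies c.Quotient (a, b) ↔
      ∀ f : ℕ → Word, c (FreeSemigroup.lift f a) (FreeSemigroup.lift f b) := by
  constructor
  · intro h f
    have := h fun i => (f i : c.Quotient)
    simp only [lift_mk] at this
    exact (Con.eq c).1 this
  · intro h f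
    obtain ⟨g, rfl⟩ : ∃ g : ℕ → Word, f = fun i => (g i : c.Quotient) := by
      choose g hg using fun i => Quotient.exists_rep (f i)
      exact ⟨g, funext fun i => (hg i).symm⟩
    simp only [lift_mk]
    exact (Con.eq c).2 (h g)

theorem quotient_mem_varS {ι : Type*} (lam : ι → Lam) (i : ι) :
    Semigrp.of (ULift.{u} (dominatedCon lam).Quotient) ∈ varS (lam i) := by
  simp only [varS, Set.mem_iInter]
  rintro j - ⟨a, b⟩ ⟨ha, hb⟩
  rw [mem_transversal_iff] at ha hb
  refine satisfies_ulift_iff.2 (satisfies_quotient_iff.2 fun f => ?_)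
  refine dominatedCon_iff.2 (Or.inr ⟨?_, i, Dominates.mset_lift ?_ f⟩)
  · rw [Word.mset_lift, Word.mset_lift, ha, hb]
  · rw [ha]; exact dominates_mset_ext1 _ _

theorem greedy_iInter_varS {ι : Type*} (lam : ι → Lam) :
    Greedy (⋂ i, varS (lam i) : Set Semigrp.{u}) := by
  rintro mu ⟨a, ha, b, -, hne, hab⟩
  have h := hab (Semigrp.of (ULift.{u} (dominatedCon lam).Quotient))
    (Set.mem_iInter.2 fun i => quotient_mem_varS lam i)
  have h' := satisfies_quotient_iff.1 (satisfies_ulift_iff.1 h) FreeSemigroup.of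
  have hid : ∀ w : Word, FreeSemigroup.lift FreeSemigroup.of w = w := fun w =>
    DFunLike.congr_fun (FreeSemigroup.lift_comp_of' (MulHom.id Word)) w
  rw [hid, hid] at h'
  rcases h' with h' | ⟨-, i, hi⟩
  · exact absurd h' hne
  · rw [mem_transversal_iff.1 ha] at hi
    exact collapses_iff.2 fun S hS => msetCollapses_of_dominates (Set.mem_iInter.1 hS i) hi

/-- The variety of all semigroups is the meet of the empty family. -/
theorem greedy_univ : Greedy (Set.univ : Set Semigrp.{u}) := by
  have h := greedy_iInter_varS.{u} (Empty.elim : Empty → Lam)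
  rwa [Set.iInter_of_empty] at h

/-! ### Greedy overcommutative varieties -/

/-- Test in the commutative semigroup of finite multisets: with each letter sent to its singleton, a
word evaluates to its own multiset. -/
theorem mset_eq_of_holdsIn {V : Set Semigrp.{u}} (hV : com ⊆ V) {a b : Word}
    (h : HoldsIn V (a, b)) : a.mset = b.mset := by
  have hmem : Semigrp.of (ULift.{u} (Multiplicative (Multiset ℕ))) ∈ com := by
    intro x y
    exact mul_comm (G := ULift.{u} (Multiplicative (Multiset ℕ))) x y
  have h' := satisfies_ulift_iff.1 (h _ (hV hmem)) fun i => Multiplicative.ofAdd {i}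
  have key : ∀ w : Word, FreeSemigroup.lift (fun i => Multiplicative.ofAdd ({i} : Multiset ℕ)) w =
      Multiplicative.ofAdd w.mset := by
    intro w
    induction w using FreeSemigroup.recOnMul with
    | ih1 x => rfl
    | ih2 x y hx hy => rw [map_mul, hx, hy, Word.mset_mul, ofAdd_add]
  simp only [key] at h'
  exact Multiplicative.ofAdd.injective h'

/-- The letters are listed by decreasing multiplicity; `g` gives the position in this list and `h`
reads it back, so no information is lost on the letters that occur. -/
theorem exists_rename {a b : Word} (hab : a.mset = b.mset) (hne : a ≠ b) :
    ∃ (mu : Lam) (g h : ℕ → ℕ), a.mset.map g = mu.mset ∧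
      a.letters.map (h ∘ g) = a.letters ∧ b.letters.map (h ∘ g) = b.letters := by
  let l : List ℕ := a.mset.toFinset.toList.mergeSort fun x y => a.mset.count y ≤ a.mset.count x
  have hperm : l.Perm a.mset.toFinset.toList := List.mergeSort_perm _ _
  have hmem : ∀ x, x ∈ l ↔ x ∈ a.mset := fun x => by
    rw [hperm.mem_iff, Finset.mem_toList, Multiset.mem_toFinset]
  have hnodup : l.Nodup := hperm.nodup_iff.2 (Finset.nodup_toList _)
  have hsort : l.Pairwise fun x y => a.mset.count y ≤ a.mset.count x := by
    have := List.pairwise_mergeSort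
      (le := fun x y => decide (a.mset.count y ≤ a.mset.count x))
      (by intro x y z hxy hyz; simp at *; omega) (by intro x y; simp; omega)
      a.mset.toFinset.toList
    simpa using this
  -- With a single letter, both words would be the same power of it.
  have hlen : 2 ≤ l.length := by
    by_contra hlt
    apply hne
    have hsub : ∀ x ∈ a.mset, ∀ y ∈ a.mset, x = y := by
      intro x hx y hy
      rw [← hmem] at hx hy
      rcases hl : l with _ | ⟨c, _ | ⟨d, t⟩⟩
      · rw [hl] at hx; simp at hx
      · rw [hl] at hx hy; simp at hx hy; rw [hx, hy]
      · rw [hl] at hlt; simp at hlt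
    apply Word.letters_injective
    have hx : a.head ∈ a.mset := by simp [Word.mset, Word.letters]
    have e1 := List.eq_replicate_of_mem (a := a.head) (l := a.letters)
      fun y hy => hsub y hy _ hx
    have e2 := List.eq_replicate_of_mem (a := a.head) (l := b.letters)
      fun y hy => hsub y (by rw [hab]; exact hy) _ hx
    have e3 : a.letters.length = b.letters.length := congrArg Multiset.card hab
    rw [e1, e2, e3]
  let mu : Lam :=
    { parts := l.map fun x => a.mset.count x
      sorted := List.pairwise_map.2 hsort
      pos := by
        intro c hc
        obtain ⟨x, hx, rfl⟩ := List.mem_map.1 hc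
        exact Multiset.count_pos.2 ((hmem x).1 hx)
      two_le := by rw [List.length_map]; exact hlen }
  have hinv : ∀ x ∈ a.mset, l.getD (l.idxOf x) 0 = x := by
    intro x hx
    have hlt : l.idxOf x < l.length := List.idxOf_lt_length_iff.2 ((hmem x).2 hx)
    rw [List.getD_eq_getElem _ _ hlt]
    exact List.getElem_idxOf hlt
  refine ⟨mu, fun x => l.idxOf x, fun i => l.getD i 0, ?_, ?_, ?_⟩
  · ext i
    rw [Lam.count_mset]
    by_cases hi : i < l.length
    · have h1 : mu.parts.getD i 0 = a.mset.count l[i] := by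
        rw [List.getD_eq_getElem _ _ (by simpa [mu] using hi)]
        simp [mu]
      have h2 : l.idxOf l[i] = i := hnodup.idxOf_getElem i hi
      rw [h1]
      conv_lhs => rw [← h2]
      refine Multiset.count_map_eq_count (fun x => l.idxOf x) a.mset ?_ _
        ((hmem _).1 (List.getElem_mem hi))
      intro x hx y hy hxy
      rw [← hinv x hx, ← hinv y hy]
      exact congrArg (fun i => l.getD i 0) hxy
    · rw [List.getD_eq_default _ _ (by simpa [mu] using hi)]
      refine Multiset.count_eq_zero_of_notMem fun hm => hi ?_
      obtain ⟨x, hx, rfl⟩ := Multiset.mem_map.1 hm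
      exact List.idxOf_lt_length_iff.2 ((hmem x).2 hx)
  · conv_rhs => rw [← List.map_id a.letters]
    exact List.map_congr_left fun x hx => hinv x hx
  · conv_rhs => rw [← List.map_id b.letters]
    exact List.map_congr_left fun x hx => hinv x (by rw [hab]; exact hx)

/-- A nontrivial identity of an overcommutative class is, up to renaming letters, an identity
between words of a transversal reduced by the class. -/
theorem exists_reduces_of_holdsIn {V : Set Semigrp.{u}} (hV : com ⊆ V) {a b : Word}
    (h : HoldsIn V (a, b)) (hne : a ≠ b) :
    ∃ mu : Lam, Reduces V mu ∧
      ∀ (S : Type u) [Semigroup S], MsetCollapses S mu.mset → Satisfies S (a, b) := by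
  have hab := mset_eq_of_holdsIn hV h
  obtain ⟨mu, g, k, hmu, hka, hkb⟩ := exists_rename hab hne
  have ha : ((a.letters.map g : List ℕ) : Multiset ℕ) = mu.mset := hmu
  have hb : ((b.letters.map g : List ℕ) : Multiset ℕ) = mu.mset := by
    rw [← hmu, hab]; rfl
  rw [← List.map_map] at hka hkb
  refine ⟨mu, ?_, ?_⟩
  · obtain ⟨a', ha'⟩ := Word.exists_letters_eq (L := a.letters.map g) (by simp [Word.letters])
    obtain ⟨b', hb'⟩ := Word.exists_letters_eq (L := b.letters.map g) (by simp [Word.letters])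
    refine ⟨a', mem_transversal_iff.2 ?_, b', mem_transversal_iff.2 ?_, ?_, fun S hS => ?_⟩
    · rw [Word.mset, ha', ha]
    · rw [Word.mset, hb', hb]
    · rintro rfl
      apply hne
      apply Word.letters_injective
      rw [← hka, ← hkb, ← ha', ← hb']
    · rw [satisfies_iff, ha', hb']
      exact (satisfies_iff.1 (h S hS)).map g
  · intro S _ hS
    have := (hS _ _ ha hb).map k
    rw [hka, hkb] at this
    exact satisfies_iff.2 this

/-- Prefixing a new letter to a nontrivial identity of the collapsed transversal keeps it
nontrivial, so the next transversal is reduced and greediness collapses it. -/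
theorem Greedy.collapses_ext1 {V : Set Semigrp.{u}} (hV : Greedy V) {lam : Lam}
    (h : Collapses V lam) (k : ℕ) : Collapses V (lam.ext1 k) := by
  induction k with
  | zero => rwa [Lam.ext1_zero]
  | succ k ih =>
    rw [Lam.ext1_succ]
    generalize lam.ext1 k = mu at ih
    apply hV
    have h2 : 2 ≤ mu.m := mu.two_le
    obtain ⟨M, hM⟩ := Multiset.exists_cons_of_mem (mu.mem_mset.2 (by omega : 0 < mu.m))
    have h1 : 1 ∈ M := by
      have := mu.mem_mset.2 (by omega : 1 < mu.m)
      rw [hM] at this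
      simpa using this
    obtain ⟨M, rfl⟩ := Multiset.exists_cons_of_mem h1
    obtain ⟨T, rfl⟩ := Quot.exists_rep M
    have e1 : ((0 :: 1 :: T : List ℕ) : Multiset ℕ) = mu.mset := hM.symm
    have e2 : ((1 :: 0 :: T : List ℕ) : Multiset ℕ) = mu.mset := by
      rw [← e1, Multiset.coe_eq_coe]; exact List.Perm.swap _ _ _
    refine ⟨⟨mu.m, 0 :: 1 :: T⟩, mem_transversal_iff.2 ?_, ⟨mu.m, 1 :: 0 :: T⟩,
      mem_transversal_iff.2 ?_, ?_, fun S hS => ?_⟩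
    · rw [Lam.mset_ext1_one, ← e1]; rfl
    · rw [Lam.mset_ext1_one, ← e2]; rfl
    · intro h
      simpa using congrArg FreeSemigroup.tail h
    · exact satisfies_iff.2 ((collapses_iff.1 ih S hS _ _ e1 e2).cons mu.m)

/-- A set of partitions has a finite subset whose members dominate all others. -/
theorem exists_finset_dominates (U : Set Lam) :
    ∃ B : Finset Lam, (∀ lam ∈ B, lam ∈ U) ∧ ∀ mu ∈ U, ∃ lam ∈ B, Dominates lam mu.mset := by
  by_contra hcon
  push Not at hcon
  -- Otherwise there is an infinite sequence in which no term dominates a later one; Higman's lemma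
  -- for lists of naturals excludes it.
  obtain ⟨f, -, hf⟩ := exists_seq_of_forall_finset_exists (· ∈ U)
    (fun lam mu => ¬ Dominates lam mu.mset) hcon
  have hwqo := Set.PartiallyWellOrderedOn.partiallyWellOrderedOn_sublistForall₂
    (α := ℕ) (s := Set.univ) (· ≤ ·) (Set.IsWF.of_wellFoundedLT Set.univ).isPWO
  obtain ⟨i, j, hij, h⟩ := hwqo (fun n => ⟨(f n).parts, fun _ _ => trivial⟩)
  exact hf i j hij (dominates_of_sublistForall₂ h)

theorem Greedy.conditionVI {V : Set Semigrp.{u}} (hV : IsOvercommutative V) (h : Greedy V) :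
    ConditionVI V := by
  obtain ⟨⟨E, rfl⟩, hcom⟩ := hV
  have hE : ∀ e ∈ E, HoldsIn (var.{u} E) e := fun e he S hS => hS e he
  obtain ⟨B, hBU, hB⟩ := exists_finset_dominates {lam | Collapses (var.{u} E) lam}
  have hsub : ∀ S : Semigrp.{u}, (∀ lam ∈ B, S ∈ varS lam) → S ∈ var E := by
    rintro S hS ⟨a, b⟩ he
    by_cases hab : a = b
    · subst hab
      exact fun _ => rfl
    · obtain ⟨mu, hmu, hsat⟩ := exists_reduces_of_holdsIn hcom (hE _ he) hab
      obtain ⟨lam, hlam, hdom⟩ := hB mu (h mu hmu)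
      exact hsat S (msetCollapses_of_dominates (hS lam hlam) hdom)
  -- An empty `B` means that nothing is collapsed, which is the case of all semigroups.
  rcases B.eq_empty_or_nonempty with rfl | hne
  · exact Or.inl (Set.eq_univ_of_forall fun S => hsub S (by simp))
  · refine Or.inr ⟨B.card, hne.card_pos, fun i => (B.equivFin.symm i : Lam), ?_⟩
    ext S
    rw [Set.mem_iInter]
    constructor
    · intro hS i
      simp only [varS, Set.mem_iInter]
      intro j _
      rw [mem_varW_iff]
      exact collapses_iff.1 (h.collapses_ext1 (hBU _ (B.equivFin.symm i).2) j) S hS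
    · intro hS
      refine hsub S fun lam hlam => ?_
      simpa using hS (B.equivFin ⟨lam, hlam⟩)

end Overcomm

theorem proposition2p3 (V : Set Semigrp.{u}) (hV : Overcomm.IsOvercommutative V) :
    Overcomm.ConditionVI V ↔ Overcomm.Greedy V := by
  constructor
  · rintro (rfl | ⟨k, -, lam, rfl⟩)
    · exact Overcomm.greedy_univ
    · exact Overcomm.greedy_iInter_varS lam
  · exact Overcomm.Greedy.conditionVI hV
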